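/- Let $\mathcal{A}$ be an abelian category; "subcategory" means a full additive subcategory closed under isomorphisms, and complexes are homologically indexed by $\mathbb{Z}$. For subcategories $\mathcal{X},\mathcal{Y}$ write $\mathcal{X}\perp\mathcal{Y}$ if $\mathrm{Ext}^n_{\mathcal{A}}(X,Y)=0$ for all $X\in\mathcal{X}$, $Y\in\mathcal{Y}$, $n\ge 1$. An $\mathcal{X}$-resolution of $M$ is a quasi-isomorphism $X\to M$ with all $X_n\in\mathcal{X}$ and $X_n=0$ for $n<0$; it is proper if the augmented complex is $\mathrm{Hom}_{\mathcal{A}}(X',-)$-exact for all $X'\in\mathcal{X}$. Write $\operatorname{res}\widehat{\mathcal{X}}$ for the class of objects of finite $\mathcal{X}$-projective dimension, i.e. those having a bounded $\mathcal{X}$-resolution. Dually, a $\mathcal{Y}$-coresolution of $N$ is a quasi-isomorphism $N\to Y$ with all $Y_n\in\mathcal{Y}$ and $Y_n=0$ for $n>0$; it is proper if the augmented complex is $\mathrm{Hom}_{\mathcal{A}}(-,Y')$-exact for all $Y'\in\mathcal{Y}$; and $\operatorname{cores}\widehat{\mathcal{Y}}$ is the class of objects of finite $\mathcal{Y}$-injective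 dimension, i.e. those having a bounded $\mathcal{Y}$-coresolution. A complex $T$ is totally $\mathcal{W}$-acyclic if it is exact, all $T_n\in\mathcal{W}$, and it is $\mathrm{Hom}_{\mathcal{A}}(W,-)$-exact and $\mathrm{Hom}_{\mathcal{A}}(-,W)$-exact for all $W\in\mathcal{W}$. Let $\mathcal{G}(\mathcal{W})$ be the subcategory of objects isomorphic to $\mathrm{Coker}(T_1\to T_0)$ for some totally $\mathcal{W}$-acyclic $T$. A Tate $\mathcal{W}$-resolution of $M$ is a diagram $T\to W\to M$ with $T$ totally $\mathcal{W}$-acyclic, $W\to M$ a proper $\mathcal{W}$-resolution, and $T_n\to W_n$ an isomorphism for $n\gg0$; then $\widehat{\mathrm{Ext}}{}^n_{\mathcal{W}\mathcal{A}}(M,N)=H_{-n}(\mathrm{Hom}_{\mathcal{A}}(T,N))$. A Tate $\mathcal{V}$-coresolution of $N$ is a diagram $N\to V\to S$ with $S$ totally $\mathcal{V}$-acyclic, $N\to V$ a proper $\mathcal{V}$-coresolution, and $V_n\to S_n$ an isomorphism for $n\ll0$; then $\widehat{\mathrm{Ext}}{}^n_{\mathcal{A}\mathcal{V}}(M,N)=H_{-n}(\mathrm{Hom}_{\mathcal{A}}(M,S))$.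 (These groups do not depend on the chosen (co)resolution.) **Theorem.** Let $\mathcal{W},\mathcal{V}$ be subcategories of $\mathcal{A}$ such that - $\mathcal{W}\perp\mathcal{W}$, $\mathcal{V}\perp\mathcal{V}$, $\mathcal{G}(\mathcal{W})\perp\mathcal{V}$ and $\mathcal{W}\perp\mathcal{G}(\mathcal{V})$; - $\mathcal{W}$ is closed under kernels of epimorphisms and direct summands, and $\mathcal{V}$ is closed under cokernels of monomorphisms and direct summands; - $\widehat{\mathrm{Ext}}{}^{n}_{\mathcal{W}\mathcal{A}}(M,V)=0$ for all $M\in\operatorname{res}\widehat{\mathcal{W}}$, $V\in\mathcal{V}$, $n\ge1$, and $\widehat{\mathrm{Ext}}{}^{n}_{\mathcal{A}\mathcal{V}}(W,N)=0$ for all $W\in\mathcal{W}$, $N\in\operatorname{cores}\widehat{\mathcal{V}}$, $n\ge1$. Then $$\operatorname{res}\widehat{\mathcal{G}(\mathcal{W})}\cap\operatorname{cores}\widehat{\mathcal{V}}\subseteq\operatorname{res}\widehat{\mathcal{W}} \qquad\text{and}\qquad \operatorname{cores}\widehat{\mathcal{G}(\mathcal{V})}\cap\operatorname{res}\widehat{\mathcal{W}}\subseteq\operatorname{cores}\widehat{\mathcal{V}}.$$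 That is, objects of finite $\mathcal{G}(\mathcal{W})$-projective dimension and finite $\mathcal{V}$-injective dimension have finite $\mathcal{W}$-projective dimension, and objects of finite $\mathcal{G}(\mathcal{V})$-injective dimension and finite $\mathcal{W}$-projective dimension have finite $\mathcal{V}$-injective dimension. -/

import Mathlib

open CategoryTheory CategoryTheory.Limits Opposite

universe w v u

namespace RelTate

noncomputable section

variable {A : Type u} [Category.{v} A] [Abelian A]

/-- `𝒳 ⊥ 𝒴`: the groups `Extⁿ(X, Y)` of the abelian category vanish for all `X` in `𝒳`,
all `Y` in `𝒴` and all `n ≥ 1`. -/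
def Perp [HasExt.{w} A] (𝒳 𝒴 : ObjectProperty A) : Prop :=
  ∀ ⦃X Y : A⦄, 𝒳 X → 𝒴 Y → ∀ n : ℕ, 1 ≤ n → Subsingleton (Abelian.Ext.{w} X Y n)

/-- For every exact sequence `0 → K → X → X' → 0` with `X` and `X'` in `𝒳`, also `K` is in `𝒳`. -/
def ClosedUnderKernelsOfEpis (𝒳 : ObjectProperty A) : Prop :=
  ∀ S : ShortComplex A, S.ShortExact → 𝒳 S.X₂ → 𝒳 S.X₃ → 𝒳 S.X₁

/-- For every exact sequence `0 → Y → Y' → K → 0` with `Y` and `Y'` in `𝒴`, also `K` is in `𝒴`. -/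
def ClosedUnderCokernelsOfMonos (𝒴 : ObjectProperty A) : Prop :=
  ∀ S : ShortComplex A, S.ShortExact → 𝒴 S.X₁ → 𝒴 S.X₂ → 𝒴 S.X₃

/-- Every direct summand (equivalently, in an abelian category, every retract) of an object of
`𝒳` is in `𝒳`. -/
def ClosedUnderDirectSummands (𝒳 : ObjectProperty A) : Prop :=
  ∀ M N : A, 𝒳 (M ⊞ N) → 𝒳 M

/-- An object regarded as a chain complex concentrated in degree `0`. -/
abbrev inDegreeZero (M : A) : ChainComplex A ℤ :=
  (HomologicalComplex.single A (ComplexShape.down ℤ) 0).obj M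

/-- The complex of abelian groups `Hom(X, K)`, for an object `X` and a chain complex `K`:
its term of index `n` is `Hom(X, K_n)`. -/
abbrev homFrom (X : A) (K : ChainComplex A ℤ) :
    HomologicalComplex AddCommGrpCat.{v} (ComplexShape.down ℤ) :=
  ((preadditiveCoyoneda.obj (op X)).mapHomologicalComplex (ComplexShape.down ℤ)).obj K

/-- The map `Hom(X, K) → Hom(X, L)` induced by a chain map `K → L`. -/
abbrev homFromMap (X : A) {K L : ChainComplex A ℤ} (f : K ⟶ L) : homFrom X K ⟶ homFrom X L :=
  ((preadditiveCoyoneda.obj (op X)).mapHomologicalComplex (ComplexShape.down ℤ)).map f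

/-- The complex of abelian groups `Hom(K, Y)`, for a chain complex `K` and an object `Y`.
It is indexed cohomologically: its term of index `n` is `Hom(K_n, Y)`, with differential
`Hom(K_n, Y) → Hom(K_{n+1}, Y)`. So index `n` here is homological degree `-n`. -/
abbrev homTo (K : ChainComplex A ℤ) (Y : A) :
    HomologicalComplex AddCommGrpCat.{v} (ComplexShape.down ℤ).symm :=
  ((preadditiveYoneda.obj Y).mapHomologicalComplex (ComplexShape.down ℤ).symm).obj
    ((HomologicalComplex.opFunctor A (ComplexShape.down ℤ)).obj (op K))

/-- The map `Hom(L, Y) → Hom(K, Y)` induced by a chain map `K → L`. -/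
abbrev homToMap {K L : ChainComplex A ℤ} (f : K ⟶ L) (Y : A) : homTo L Y ⟶ homTo K Y :=
  ((preadditiveYoneda.obj Y).mapHomologicalComplex (ComplexShape.down ℤ).symm).map
    ((HomologicalComplex.opFunctor A (ComplexShape.down ℤ)).map f.op)

/-- `γ : X → M` is an `𝒳`-resolution of `M`: a quasi-isomorphism from a chain complex `X` of
objects of `𝒳` with `X_n = 0` for `n < 0`. -/
structure IsResolution (𝒳 : ObjectProperty A) {M : A} (X : ChainComplex A ℤ)
    (γ : X ⟶ inDegreeZero M) : Prop where
  mem : ∀ n : ℤ, 𝒳 (X.X n)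
  isZero : ∀ n : ℤ, n < 0 → IsZero (X.X n)
  quasiIso : QuasiIso γ

/-- The resolution `γ : X → M` is proper: the augmented resolution stays exact under `Hom(X', -)`
for all `X'` in `𝒳`, that is, `Hom(X', γ)` is a quasi-isomorphism. -/
structure IsProperResolution (𝒳 : ObjectProperty A) {M : A} (X : ChainComplex A ℤ)
    (γ : X ⟶ inDegreeZero M) : Prop extends IsResolution 𝒳 X γ where
  proper : ∀ X' : A, 𝒳 X' → QuasiIso (homFromMap X' γ)

/-- `δ : N → Y` is a `𝒴`-coresolution of `N`: a quasi-isomorphism to a chain complex `Y` of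
objects of `𝒴` with `Y_n = 0` for `n > 0`. -/
structure IsCoresolution (𝒴 : ObjectProperty A) {N : A} (Y : ChainComplex A ℤ)
    (δ : inDegreeZero N ⟶ Y) : Prop where
  mem : ∀ n : ℤ, 𝒴 (Y.X n)
  isZero : ∀ n : ℤ, 0 < n → IsZero (Y.X n)
  quasiIso : QuasiIso δ

/-- The coresolution `δ : N → Y` is proper: the augmented coresolution stays exact under
`Hom(-, Y')` for all `Y'` in `𝒴`, that is, `Hom(δ, Y')` is a quasi-isomorphism. -/
structure IsProperCoresolution (𝒴 : ObjectProperty A) {N : A} (Y : ChainComplex A ℤ)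
    (δ : inDegreeZero N ⟶ Y) : Prop extends IsCoresolution 𝒴 Y δ where
  proper : ∀ Y' : A, 𝒴 Y' → QuasiIso (homToMap δ Y')

/-- `res 𝒳^`: the objects of finite `𝒳`-projective dimension, that is, the objects with an
`𝒳`-resolution `X` such that, for some `d`, `X_n = 0` for all `n > d`. -/
def finiteProjDim (𝒳 : ObjectProperty A) : ObjectProperty A := fun M =>
  ∃ (d : ℕ) (X : ChainComplex A ℤ) (γ : X ⟶ inDegreeZero M),
    IsResolution 𝒳 X γ ∧ ∀ n : ℤ, (d : ℤ) < n → IsZero (X.X n)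

/-- `cores 𝒴^`: the objects of finite `𝒴`-injective dimension, that is, the objects with a
`𝒴`-coresolution `Y` such that, for some `d`, `Y_n = 0` for all `n < -d`. -/
def finiteInjDim (𝒴 : ObjectProperty A) : ObjectProperty A := fun N =>
  ∃ (d : ℕ) (Y : ChainComplex A ℤ) (δ : inDegreeZero N ⟶ Y),
    IsCoresolution 𝒴 Y δ ∧ ∀ n : ℤ, n < -(d : ℤ) → IsZero (Y.X n)

/-- A totally `𝒲`-acyclic complex: an exact (unbounded) complex of objects of `𝒲` that stays
exact under `Hom(W, -)` and `Hom(-, W)` for all `W` in `𝒲`. -/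
structure IsTotallyAcyclic (𝒲 : ObjectProperty A) (T : ChainComplex A ℤ) : Prop where
  mem : ∀ n : ℤ, 𝒲 (T.X n)
  exact : T.Acyclic
  hom_from_exact : ∀ W : A, 𝒲 W → (homFrom W T).Acyclic
  hom_to_exact : ∀ W : A, 𝒲 W → (homTo T W).Acyclic

/-- `𝒢(𝒲)`: the objects isomorphic to `Coker(T_1 → T_0)` for some totally `𝒲`-acyclic `T`. -/
def gorenstein (𝒲 : ObjectProperty A) : ObjectProperty A := fun M =>
  ∃ T : ChainComplex A ℤ, IsTotallyAcyclic 𝒲 T ∧ Nonempty (M ≅ cokernel (T.d 1 0))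

/-- A Tate `𝒲`-resolution `T → W → M`: `T` is totally `𝒲`-acyclic, `W → M` is a proper
`𝒲`-resolution, and `T_n → W_n` is an isomorphism for all large `n`. -/
structure TateResolution (𝒲 : ObjectProperty A) (M : A) where
  T : ChainComplex A ℤ
  W : ChainComplex A ℤ
  α : T ⟶ W
  γ : W ⟶ inDegreeZero M
  totallyAcyclic : IsTotallyAcyclic 𝒲 T
  proper : IsProperResolution 𝒲 W γ
  eventually_iso : ∃ d : ℤ, ∀ n : ℤ, d ≤ n → IsIso (α.f n)

/-- A Tate `𝒱`-coresolution `N → V → S`: `S` is totally `𝒱`-acyclic, `N → V` is a proper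
`𝒱`-coresolution, and `V_n → S_n` is an isomorphism for all sufficiently negative `n`. -/
structure TateCoresolution (𝒱 : ObjectProperty A) (N : A) where
  V : ChainComplex A ℤ
  S : ChainComplex A ℤ
  δ : inDegreeZero N ⟶ V
  β : V ⟶ S
  totallyAcyclic : IsTotallyAcyclic 𝒱 S
  proper : IsProperCoresolution 𝒱 V δ
  eventually_iso : ∃ d : ℤ, ∀ n : ℤ, n ≤ d → IsIso (β.f n)

/-- Tate cohomology of `(M, N)` relative to `𝒲` in the first variable, computed by a Tate
`𝒲`-resolution `T → W → M`: the group `H_{-n}(Hom(T, N))`. -/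
def TateResolution.tateExt {𝒲 : ObjectProperty A} {M : A} (R : TateResolution 𝒲 M) (N : A)
    (n : ℤ) : AddCommGrpCat.{v} :=
  (homTo R.T N).homology n

/-- Tate cohomology of `(M, N)` relative to `𝒱` in the second variable, computed by a Tate
`𝒱`-coresolution `N → V → S`: the group `H_{-n}(Hom(M, S))`. -/
def TateCoresolution.tateExt {𝒱 : ObjectProperty A} {N : A} (R : TateCoresolution 𝒱 N) (M : A)
    (n : ℤ) : AddCommGrpCat.{v} :=
  (homFrom M R.S).homology (-n)

/-- The vanishing, for all `n ≥ 1`, of the `n`-th Tate cohomology relative to `𝒲` in the first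
variable, on `𝒳 × 𝒴`. -/
def TateExtVanishesLeft (𝒲 𝒳 𝒴 : ObjectProperty A) : Prop :=
  ∀ ⦃M N : A⦄, 𝒳 M → 𝒴 N → ∀ (R : TateResolution 𝒲 M) (n : ℤ), 1 ≤ n → IsZero (R.tateExt N n)

/-- The vanishing, for all `n ≥ 1`, of the `n`-th Tate cohomology relative to `𝒱` in the second
variable, on `𝒳 × 𝒴`. -/
def TateExtVanishesRight (𝒱 𝒳 𝒴 : ObjectProperty A) : Prop :=
  ∀ ⦃M N : A⦄, 𝒳 M → 𝒴 N → ∀ (R : TateCoresolution 𝒱 N) (n : ℤ), 1 ≤ n → IsZero (R.tateExt M n)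

end

end RelTate

/-! Let `M` have a finite resolution by `gorenstein W` and a finite coresolution by `V`.
Auslander-Buchweitz approximation embeds `M` in some `K` with a finite resolution by `W`, the
cokernel `G` being of Gorenstein type (`IsCoresolvedClass.exists_hull`). It suffices that `G` lies
in `W`: a kernel of `K → G` then inherits a finite resolution by `W`, since `W` is closed under
kernels of epimorphisms.

The key fact is `Extⁿ(Y, M) = 0` for all `Y` of Gorenstein type and `n ≥ 1`. For large `n` it
follows from `Y ⊥ V` and the finite coresolution of `M`. Moreover `Y` embeds in an object of `W`
with cokernel of the same type, and `W ⊥ M`, so the vanishing descends to every degree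
(`IsCoresolvedClass.dimension_shift`). Now embed `G` in `X` from `W` with cokernel `Z`. Exactness of
`Ext¹(Z, K) → Ext¹(Z, G) → Ext²(Z, M)`, with both ends zero, splits the embedding, and `G` is a
direct summand of `X`.

The approximation needs a class closed under extensions. Rather than building complete resolutions
of extensions of Gorenstein objects, the proof keeps only the right half of a complete resolution
and takes the largest class so described, `maxCoresolved`. Only formal properties of Ext vanishing
enter, collected in the self-dual `IsExtVanishing`, so the second inclusion is the first one in the
opposite category. -/

namespace RelTate

/-! ### Short exact sequences: pushouts and composites. -/

section Core

variable {B : Type u} [Category.{v} B] [Abelian B]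

/-- There is a short exact sequence `0 → X → Y → Z → 0`. -/
def Ses (X Y Z : B) : Prop :=
  ∃ (i : X ⟶ Y) (p : Y ⟶ Z) (w : i ≫ p = 0), (ShortComplex.mk i p w).ShortExact

lemma Ses.of_shortExact {S : ShortComplex B} (h : S.ShortExact) : Ses S.X₁ S.X₂ S.X₃ :=
  ⟨S.f, S.g, S.zero, h⟩

lemma Ses.of_iso {X Y Z X' Y' Z' : B} (h : Ses X Y Z) (a : X ≅ X') (b : Y ≅ Y') (c : Z ≅ Z') :
    Ses X' Y' Z' := by
  obtain ⟨i, p, w, h⟩ := h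
  refine ⟨a.inv ≫ i ≫ b.hom, b.inv ≫ p ≫ c.hom, by simp [reassoc_of% w], ?_⟩
  exact ShortComplex.shortExact_of_iso (ShortComplex.isoMk a b c (by simp) (by simp)) h

lemma Ses.op {X Y Z : B} (h : Ses X Y Z) : Ses (op Z) (op Y) (op X) := by
  obtain ⟨i, p, w, h⟩ := h
  exact Ses.of_shortExact h.op

lemma Ses.unop {X Y Z : Bᵒᵖ} (h : Ses X Y Z) : Ses Z.unop Y.unop X.unop := by
  obtain ⟨i, p, w, h⟩ := h
  exact Ses.of_shortExact h.unop

lemma shortExact_of_isColimit {X Y Z : B} (i : X ⟶ Y) [Mono i] (p : Y ⟶ Z) (w : i ≫ p = 0)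
    (h : IsColimit (CokernelCofork.ofπ p w)) : (ShortComplex.mk i p w).ShortExact :=
  { exact := ShortComplex.exact_of_g_is_cokernel _ h
    mono_f := inferInstanceAs (Mono i)
    epi_g := Cofork.IsColimit.epi h }

lemma shortExact_cokernel {X Y : B} (i : X ⟶ Y) [Mono i] :
    (ShortComplex.mk i (cokernel.π i) (cokernel.condition i)).ShortExact :=
  shortExact_of_isColimit _ _ _ (cokernelIsCokernel i)

/-- The cokernel of a monomorphism is preserved by cobase change along a monomorphism. -/
lemma ses_pushout_inl {X₁ X₂ Y₂ Y₃ : B} (f : X₁ ⟶ X₂) (f' : X₁ ⟶ Y₂) (g' : Y₂ ⟶ Y₃)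
    (w' : f' ≫ g' = 0) (h' : (ShortComplex.mk f' g' w').ShortExact) :
    Ses X₂ (pushout f f') Y₃ := by
  have := h'.mono_f
  have := h'.epi_g
  dsimp at *
  let p : pushout f f' ⟶ Y₃ := pushout.desc 0 g' (by simp [w'])
  have hp : pushout.inl f f' ≫ p = 0 := pushout.inl_desc _ _ _
  have hp' : pushout.inr f f' ≫ p = g' := pushout.inr_desc _ _ _
  refine ⟨pushout.inl f f', p, hp, shortExact_of_isColimit _ _ _ ?_⟩
  have hl : ∀ {T : B} (t : pushout f f' ⟶ T), pushout.inl f f' ≫ t = 0 →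
      f' ≫ pushout.inr f f' ≫ t = 0 := fun t ht => by
    rw [← pushout.condition_assoc, ht, comp_zero]
  refine CokernelCofork.IsColimit.ofπ _ _
    (fun t ht => h'.exact.desc (pushout.inr f f' ≫ t) (hl t ht)) (fun t ht => ?_)
    (fun t ht m hm => ?_)
  · apply pushout.hom_ext
    · rw [reassoc_of% hp, ht, zero_comp]
    · rw [reassoc_of% hp']
      exact h'.exact.g_desc _ (hl t ht)
  · rw [← cancel_epi g']
    refine Eq.trans ?_ (h'.exact.g_desc _ (hl t ht)).symm
    rw [← hm, reassoc_of% hp']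

/-- Cobase change preserves the cokernel of either leg; `Q` is the pushout over `X₁`. -/
lemma Ses.exists_pushout {X₁ X₂ X₃ Y₂ Y₃ : B} (h : Ses X₁ X₂ X₃) (h' : Ses X₁ Y₂ Y₃) :
    ∃ Q, Ses X₂ Q Y₃ ∧ Ses Y₂ Q X₃ := by
  obtain ⟨f, g, w, h⟩ := h
  obtain ⟨f', g', w', h'⟩ := h'
  exact ⟨pushout f f', ses_pushout_inl f f' g' w' h',
    (ses_pushout_inl f' f g w h).of_iso (Iso.refl _) (pushoutSymmetry f' f) (Iso.refl _)⟩

/-- The third isomorphism theorem, with `P = Y/X`, `Q = Z/X` and `R = Z/Y`. -/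
lemma Ses.comp {X Y Z P R : B} (h : Ses X Y P) (h' : Ses Y Z R) :
    ∃ Q, Ses X Z Q ∧ Ses P Q R := by
  obtain ⟨f, p, w, h⟩ := h
  obtain ⟨g, q, w', h'⟩ := h'
  have : Mono f := h.mono_f
  have : Mono g := h'.mono_f
  refine ⟨cokernel (f ≫ g), Ses.of_shortExact (shortExact_cokernel (f ≫ g)), ?_⟩
  -- Since `p` is the cokernel of `f`, a map from `Z` killing `f ≫ g` is the same as a cocone on `g`
  -- and `p`.
  obtain ⟨e⟩ : Nonempty (pushout g p ≅ cokernel (f ≫ g)) := by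
    have : Epi p := h.epi_g
    obtain ⟨t, ht⟩ : ∃ t : P ⟶ cokernel (f ≫ g), p ≫ t = g ≫ cokernel.π (f ≫ g) :=
      ⟨h.exact.desc (g ≫ cokernel.π (f ≫ g)) (by simp [← Category.assoc]), h.exact.g_desc _ _⟩
    have hw : (f ≫ g) ≫ pushout.inl g p = 0 := by
      rw [Category.assoc, pushout.condition, reassoc_of% w, zero_comp]
    have hl : pushout.inl g p ≫ pushout.desc _ t ht.symm = cokernel.π (f ≫ g) :=
      pushout.inl_desc _ _ _
    have hr : pushout.inr g p ≫ pushout.desc _ t ht.symm = t := pushout.inr_desc _ _ _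
    refine ⟨⟨pushout.desc _ t ht.symm, cokernel.desc _ (pushout.inl g p) hw, ?_, ?_⟩⟩
    · apply pushout.hom_ext
      · rw [reassoc_of% hl, cokernel.π_desc, Category.comp_id]
      · rw [reassoc_of% hr, ← cancel_epi p, reassoc_of% ht, cokernel.π_desc, pushout.condition,
          Category.comp_id]
    · rw [← cancel_epi (cokernel.π (f ≫ g)), cokernel.π_desc_assoc, hl, Category.comp_id]
  exact (ses_pushout_inl p g q w' h').of_iso (Iso.refl _) (pushoutSymmetry p g ≪≫ e) (Iso.refl _)

/-- Dual to `Ses.comp`: `Q` is the preimage of `M` in `W`, equally the kernel of `W → K → G`. -/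
lemma Ses.comp_epi {L W K M G : B} (h : Ses L W K) (h' : Ses M K G) :
    ∃ Q, Ses Q W G ∧ Ses L Q M := by
  obtain ⟨Q, h₁, h₂⟩ := h'.op.comp h.op
  exact ⟨Q.unop, h₁.unop, h₂.unop⟩

/-! ### Finite dimension by iterated syzygies. -/

/-- `M` has a resolution of length `n` by objects of `P`, expressed by iterated syzygies. -/
def HasResDim (P : ObjectProperty B) : ℕ → B → Prop
  | 0, M => P M
  | n + 1, M => ∃ K X, P X ∧ Ses K X M ∧ HasResDim P n K

/-- `M` has a coresolution of length `n` by objects of `P`, expressed by iterated cosyzygies. -/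
def HasCoresDim (P : ObjectProperty B) : ℕ → B → Prop
  | 0, M => P M
  | n + 1, M => ∃ X K, P X ∧ Ses M X K ∧ HasCoresDim P n K

lemma hasResDim_op_iff (P : ObjectProperty B) (n : ℕ) (M : B) :
    HasResDim P.op n (op M) ↔ HasCoresDim P n M := by
  induction n generalizing M with
  | zero => rfl
  | succ n ih =>
    constructor
    · rintro ⟨K, X, hX, h, hK⟩
      exact ⟨X.unop, K.unop, hX, h.unop, (ih _).1 hK⟩
    · rintro ⟨X, K, hX, h, hK⟩
      exact ⟨op K, op X, hX, h.op, (ih _).2 hK⟩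

lemma hasCoresDim_op_iff (P : ObjectProperty B) (n : ℕ) (M : B) :
    HasCoresDim P.op n (op M) ↔ HasResDim P n M := by
  induction n generalizing M with
  | zero => rfl
  | succ n ih =>
    constructor
    · rintro ⟨X, K, hX, h, hK⟩
      exact ⟨K.unop, X.unop, hX, h.unop, (ih _).1 hK⟩
    · rintro ⟨K, X, hX, h, hK⟩
      exact ⟨op X, op K, hX, h.op, (ih _).2 hK⟩

lemma HasResDim.mono {P Q : ObjectProperty B} (hPQ : ∀ X, P X → Q X) {n : ℕ} {M : B}
    (h : HasResDim P n M) : HasResDim Q n M := by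
  induction n generalizing M with
  | zero => exact hPQ _ h
  | succ n ih =>
    obtain ⟨K, X, hX, h, hK⟩ := h
    exact ⟨K, X, hPQ _ hX, h, ih hK⟩

/-! ### Formal Ext vanishing, coresolved classes and approximation. -/

/-- A family of conditions `E n X Y` that behaves like the vanishing of `Extⁿ⁺¹(X, Y)`. -/
structure IsExtVanishing (E : ℕ → B → B → Prop) : Prop where
  cov₁ : ∀ {X Y Z T : B} {n : ℕ}, Ses X Y Z → E n T Z → E (n + 1) T Y → E (n + 1) T X
  cov₂ : ∀ {X Y Z T : B} {n : ℕ}, Ses X Y Z → E n T X → E n T Z → E n T Y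
  cov₃ : ∀ {X Y Z T : B} {n : ℕ}, Ses X Y Z → E n T Y → E (n + 1) T X → E n T Z
  con₁ : ∀ {X Y Z T : B} {n : ℕ}, Ses X Y Z → E n Y T → E (n + 1) Z T → E n X T
  con₂ : ∀ {X Y Z T : B} {n : ℕ}, Ses X Y Z → E n X T → E n Z T → E n Y T
  con₃ : ∀ {X Y Z T : B} {n : ℕ}, Ses X Y Z → E n X T → E (n + 1) Y T → E (n + 1) Z T
  split : ∀ {X Y Z : B}, Ses X Y Z → E 0 Z X → Ses Z Y X

/-- The covariant and contravariant axioms trade places, so no Ext groups of the opposite category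
are needed. -/
lemma IsExtVanishing.op {E : ℕ → B → B → Prop} (hE : IsExtVanishing E) :
    IsExtVanishing (B := Bᵒᵖ) (fun n X Y => E n Y.unop X.unop) where
  cov₁ h := hE.con₃ h.unop
  cov₂ h h₁ h₂ := hE.con₂ h.unop h₂ h₁
  cov₃ h := hE.con₁ h.unop
  con₁ h := hE.cov₃ h.unop
  con₂ h h₁ h₂ := hE.cov₂ h.unop h₂ h₁
  con₃ h := hE.cov₁ h.unop
  split h h₁ := (hE.split h.unop h₁).op

/-- A class of objects with coresolutions by objects of `W` all of whose cosyzygies are again in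
the class, and satisfying the orthogonality relations with `W` and `V`. -/
structure IsCoresolvedClass (E : ℕ → B → B → Prop) (W V P : ObjectProperty B) : Prop where
  right : ∀ {Y : B}, P Y → ∃ X Z, W X ∧ P Z ∧ Ses Y X Z
  perp_left : ∀ {Y X : B}, P Y → W X → ∀ n, E n Y X
  perp_right : ∀ {Y X : B}, P Y → W X → ∀ n, E n X Y
  perp_other : ∀ {Y X : B}, P Y → V X → ∀ n, E n Y X

/-- The union of all classes satisfying `IsCoresolvedClass`. -/
def maxCoresolved (E : ℕ → B → B → Prop) (W V : ObjectProperty B) : ObjectProperty B :=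
  fun Y => ∃ P, IsCoresolvedClass E W V P ∧ P Y

variable {E : ℕ → B → B → Prop} {W V : ObjectProperty B}

lemma isCoresolvedClass_max (E : ℕ → B → B → Prop) (W V : ObjectProperty B) :
    IsCoresolvedClass E W V (maxCoresolved E W V) where
  right := by
    rintro Y ⟨P, hP, hY⟩
    obtain ⟨X, Z, hX, hZ, h⟩ := hP.right hY
    exact ⟨X, Z, hX, ⟨P, hP, hZ⟩, h⟩
  perp_left := by
    rintro Y X ⟨P, hP, hY⟩
    exact hP.perp_left hY
  perp_right := by
    rintro Y X ⟨P, hP, hY⟩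
    exact hP.perp_right hY
  perp_other := by
    rintro Y X ⟨P, hP, hY⟩
    exact hP.perp_other hY

/-- A one-sided horseshoe lemma. Applied to `maxCoresolved`, it shows that class to be closed under
extensions, by maximality. -/
lemma IsCoresolvedClass.extensions (hE : IsExtVanishing E)
    (hWext : ∀ {X Y Z : B}, Ses X Y Z → W X → W Z → W Y)
    {P : ObjectProperty B} (hP : IsCoresolvedClass E W V P) :
    IsCoresolvedClass E W V (fun Y => ∃ G G', P G ∧ P G' ∧ Ses G Y G') where
  right := by
    rintro Y ⟨G, G', hG, hG', h⟩
    obtain ⟨X, H, hX, hH, hs⟩ := hP.right hG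
    obtain ⟨X', H', hX', hH', hs'⟩ := hP.right hG'
    obtain ⟨E₁, h₁, h₂⟩ := h.exists_pushout hs
    -- The extension `E₁` of `G'` by `X` splits, so `G'` is also a subobject of it and can be pushed
    -- out along `G' → X'`.
    obtain ⟨Q, h₃, h₄⟩ := (hE.split h₂ (hP.perp_left hG' hX 0)).exists_pushout hs'
    obtain ⟨R, h₅, h₆⟩ := h₁.comp h₃
    exact ⟨Q, R, hWext h₄ hX' hX, ⟨H, H', hH, hH', h₆⟩, h₅⟩
  perp_left := by
    rintro Y X ⟨G, G', hG, hG', h⟩ hX n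
    exact hE.con₂ h (hP.perp_left hG hX n) (hP.perp_left hG' hX n)
  perp_right := by
    rintro Y X ⟨G, G', hG, hG', h⟩ hX n
    exact hE.cov₂ h (hP.perp_right hG hX n) (hP.perp_right hG' hX n)
  perp_other := by
    rintro Y X ⟨G, G', hG, hG', h⟩ hX n
    exact hE.con₂ h (hP.perp_other hG hX n) (hP.perp_other hG' hX n)

lemma perp_of_hasResDim (hE : IsExtVanishing E) {P : ObjectProperty B} {Y : B}
    (hY : ∀ {X : B}, P X → ∀ n, E n Y X) {d : ℕ} {M : B} (hM : HasResDim P d M) (n : ℕ) :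
    E n Y M := by
  induction d generalizing M n with
  | zero => exact hY hM n
  | succ d ih =>
    obtain ⟨K, X, hX, h, hK⟩ := hM
    exact hE.cov₃ h (hY hX n) (ih hK (n + 1))

/-- Each cosyzygy lowers the Ext degree by one, so the vanishing survives only from degree `d + 1`
on, that is, for `d ≤ n`. -/
lemma perp_of_hasCoresDim (hE : IsExtVanishing E) {P : ObjectProperty B} {Y : B}
    (hY : ∀ {X : B}, P X → ∀ n, E n Y X) {d : ℕ} {M : B} (hM : HasCoresDim P d M) (n : ℕ)
    (hn : d ≤ n) : E n Y M := by
  induction d generalizing M n with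
  | zero => exact hY hM n
  | succ d ih =>
    obtain ⟨X, K, hX, h, hK⟩ := hM
    obtain ⟨n, rfl⟩ : ∃ m, n = m + 1 := ⟨n - 1, by omega⟩
    exact hE.cov₁ h (ih hK n (by omega)) (hY hX _)

/-- Replacing `Y` by its cosyzygy raises the Ext degree by one, because the middle term from `W`
contributes nothing; after `k` replacements the degree is in the range of `hd`. -/
lemma IsCoresolvedClass.dimension_shift (hE : IsExtVanishing E) {P : ObjectProperty B}
    (hP : IsCoresolvedClass E W V P) {M : B} (hM : ∀ {X : B}, W X → ∀ n, E n X M) {d : ℕ}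
    (hd : ∀ {Y : B}, P Y → ∀ n, d ≤ n → E n Y M) (k : ℕ) {Y : B} (hY : P Y) (n : ℕ)
    (hn : d ≤ n + k) : E n Y M := by
  induction k generalizing Y n with
  | zero => exact hd hY n hn
  | succ k ih =>
    obtain ⟨X, Z, hX, hZ, h⟩ := hP.right hY
    exact hE.con₁ h (hM hX n) (ih hZ (n + 1) (by omega))

/-- Auslander-Buchweitz approximation: an object with a finite resolution by objects of an
extension-closed coresolved class embeds in an object with a finite resolution by objects of `W`,
with cokernel in the class. -/
lemma IsCoresolvedClass.exists_hull {P : ObjectProperty B} (hP : IsCoresolvedClass E W V P)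
    (hPext : ∀ {X Y Z : B}, Ses X Y Z → P X → P Z → P Y) {d : ℕ} {M : B}
    (hM : HasResDim P d M) : ∃ K G, HasResDim W d K ∧ P G ∧ Ses M K G := by
  induction d generalizing M with
  | zero =>
    obtain ⟨X, Z, hX, hZ, h⟩ := hP.right hM
    exact ⟨X, Z, hX, hZ, h⟩
  | succ d ih =>
    obtain ⟨M', G, hG, h, hM'⟩ := hM
    obtain ⟨K', G', hK', hG', h'⟩ := ih hM'
    -- `Q` is an extension of `G'` by `G`, hence in `P`, and also an extension of `M` by `K'`.
    -- Embedding `Q` in `X` gives `K = X/K'`, which contains `M = Q/K'`.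
    obtain ⟨Q, h₁, h₂⟩ := h.exists_pushout h'
    obtain ⟨X, G'', hX, hG'', h₃⟩ := hP.right (hPext h₁ hG hG')
    obtain ⟨K, h₄, h₅⟩ := h₂.comp h₃
    exact ⟨K, G'', ⟨K', X, hX, h₄, hK'⟩, hG'', h₅⟩

theorem IsCoresolvedClass.hasResDim (hE : IsExtVanishing E)
    (hWext : ∀ {X Y Z : B}, Ses X Y Z → W X → W Z → W Y)
    (hWker : ∀ {X Y Z : B}, Ses X Y Z → W Y → W Z → W X)
    (hWsplit : ∀ {X Y Z : B}, Ses X Y Z → E 0 Z X → W Y → W X)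
    {P : ObjectProperty B} (hP : IsCoresolvedClass E W V P) {d e : ℕ} {M : B}
    (hM : HasResDim P d M) (hM' : HasCoresDim V e M) : HasResDim W d M := by
  have hC := isCoresolvedClass_max E W V
  obtain ⟨K, G, hK, hG, h⟩ := hC.exists_hull
    (fun h hX hZ => ⟨_, hC.extensions hE hWext, _, _, hX, hZ, h⟩)
    (hM.mono fun X hX => ⟨P, hP, hX⟩)
  have hperp : ∀ {Y : B}, maxCoresolved E W V Y → ∀ n, E n Y M := fun hY n =>
    hC.dimension_shift hE (fun hX => perp_of_hasResDim hE (fun hY => hP.perp_right hY hX) hM)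
      (fun hY => perp_of_hasCoresDim hE (hC.perp_other hY) hM') e hY n (by omega)
  have hGW : W G := by
    -- The sequence `G → X → Z` splits because `Ext¹(Z, G)` lies between `Ext¹(Z, K) = 0` and
    -- `Ext²(Z, M) = 0`.
    obtain ⟨X, Z, hX, hZ, h'⟩ := hC.right hG
    exact hWsplit h' (hE.cov₃ h (perp_of_hasResDim hE (hC.perp_left hZ) hK 0) (hperp hZ 1)) hX
  cases d with
  | zero => exact hWker h hK hGW
  | succ d =>
    obtain ⟨L, X, hX, h', hL⟩ := hK
    -- `Q` is the kernel of `X → K → G`, hence in `W`, and it maps onto `M` with the same kernel `L`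
    -- as `X → K`.
    obtain ⟨Q, h₁, h₂⟩ := h'.comp_epi h
    exact ⟨L, Q, hWker h₁ hX hGW, h₂, hL⟩

end Core

end RelTate

namespace RelTate

/-! ### Vanishing of the actual Ext groups. -/

section ExtVanishing

variable {A : Type u} [Category.{v} A] [Abelian A]

lemma ses_of_splitting {S : ShortComplex A} (s : S.Splitting) : Ses S.X₃ S.X₂ S.X₁ := by
  let S' : ShortComplex A := ShortComplex.mk s.s s.r s.s_r
  have s' : S'.Splitting :=
    { r := S.g
      s := S.f
      f_r := s.s_g
      s_g := s.f_r
      id := (add_comm _ _).trans s.id }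
  exact Ses.of_shortExact s'.shortExact

variable [HasExt.{w} A]

lemma subsingleton_ext_of_forall {X Y : A} {n : ℕ} (h : ∀ x : Abelian.Ext.{w} X Y n, x = 0) :
    Subsingleton (Abelian.Ext.{w} X Y n) :=
  ⟨fun a b => (h a).trans (h b).symm⟩

/-- If every map `T ⟶ Z` lifts to `Y` and `Ext¹(T, Y) = 0`, then `Ext¹(T, X) = 0`. -/
lemma subsingleton_ext_one_of_lift {S : ShortComplex A} (hS : S.ShortExact) {T : A}
    (hl : ∀ f : T ⟶ S.X₃, ∃ g : T ⟶ S.X₂, g ≫ S.g = f)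
    [Subsingleton (Abelian.Ext.{w} T S.X₂ 1)] : Subsingleton (Abelian.Ext.{w} T S.X₁ 1) := by
  refine subsingleton_ext_of_forall fun x => ?_
  obtain ⟨y, rfl⟩ := Abelian.Ext.covariant_sequence_exact₁ T hS x (Subsingleton.elim _ _)
    (zero_add 1)
  obtain ⟨f, rfl⟩ := (Abelian.Ext.mk₀_bijective _ _).2 y
  obtain ⟨g, rfl⟩ := hl f
  rw [← Abelian.Ext.mk₀_comp_mk₀, Abelian.Ext.comp_assoc_of_second_deg_zero, hS.comp_extClass,
    Abelian.Ext.comp_zero]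

/-- If every map `X ⟶ T` extends to `Y` and `Ext¹(Y, T) = 0`, then `Ext¹(Z, T) = 0`. -/
lemma subsingleton_ext_one_of_extend {S : ShortComplex A} (hS : S.ShortExact) {T : A}
    (hl : ∀ f : S.X₁ ⟶ T, ∃ g : S.X₂ ⟶ T, S.f ≫ g = f)
    [Subsingleton (Abelian.Ext.{w} S.X₂ T 1)] : Subsingleton (Abelian.Ext.{w} S.X₃ T 1) := by
  refine subsingleton_ext_of_forall fun x => ?_
  obtain ⟨y, rfl⟩ := Abelian.Ext.contravariant_sequence_exact₃ hS T x (Subsingleton.elim _ _)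
    (add_zero 1)
  obtain ⟨f, rfl⟩ := (Abelian.Ext.mk₀_bijective _ _).2 y
  obtain ⟨g, rfl⟩ := hl f
  rw [← Abelian.Ext.mk₀_comp_mk₀, hS.extClass_comp_assoc]

/-- The obstruction to lifting the identity of `S.X₃` along `S.g` lies in `Ext¹(S.X₃, S.X₁)`. -/
lemma splitting_of_subsingleton_ext {S : ShortComplex A} (hS : S.ShortExact)
    [Subsingleton (Abelian.Ext.{w} S.X₃ S.X₁ 1)] : Nonempty S.Splitting := by
  obtain ⟨x, hx⟩ := Abelian.Ext.covariant_sequence_exact₃ S.X₃ hS (Abelian.Ext.mk₀.{w} (𝟙 S.X₃))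
    (zero_add 1) (Subsingleton.elim _ _)
  obtain ⟨g, rfl⟩ := (Abelian.Ext.mk₀_bijective _ _).2 x
  rw [Abelian.Ext.mk₀_comp_mk₀] at hx
  have := hS.mono_f
  exact ⟨.ofExactOfSection _ hS.exact g ((Abelian.Ext.mk₀_bijective _ _).1 hx) inferInstance⟩

lemma splitting_of_ses {X Y Z : A} (h : Ses X Y Z) [Subsingleton (Abelian.Ext.{w} Z X 1)] :
    Nonempty (Y ≅ X ⊞ Z) ∧ Ses Z Y X := by
  obtain ⟨i, p, w, h⟩ := h
  obtain ⟨s⟩ := splitting_of_subsingleton_ext h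
  exact ⟨⟨s.isoBinaryBiproduct⟩, ses_of_splitting s⟩

variable (A) in
lemma isExtVanishing_ext : IsExtVanishing (B := A)
    (fun n X Y => Subsingleton (Abelian.Ext.{w} X Y (n + 1))) where
  cov₁ := by
    rintro X Y Z T n ⟨i, p, w, h⟩ h₁ h₂
    refine subsingleton_ext_of_forall fun x => ?_
    obtain ⟨y, rfl⟩ := Abelian.Ext.covariant_sequence_exact₁ T h x (Subsingleton.elim _ _) rfl
    rw [Subsingleton.elim (α := Abelian.Ext.{w} T Z (n + 1)) y 0, Abelian.Ext.zero_comp]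
  cov₂ := by
    rintro X Y Z T n ⟨i, p, w, h⟩ h₁ h₂
    refine subsingleton_ext_of_forall fun x => ?_
    obtain ⟨y, rfl⟩ := Abelian.Ext.covariant_sequence_exact₂ T h x (Subsingleton.elim _ _)
    rw [Subsingleton.elim (α := Abelian.Ext.{w} T X (n + 1)) y 0, Abelian.Ext.zero_comp]
  cov₃ := by
    rintro X Y Z T n ⟨i, p, w, h⟩ h₁ h₂
    refine subsingleton_ext_of_forall fun x => ?_
    obtain ⟨y, rfl⟩ := Abelian.Ext.covariant_sequence_exact₃ T h x rfl (Subsingleton.elim _ _)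
    rw [Subsingleton.elim (α := Abelian.Ext.{w} T Y (n + 1)) y 0, Abelian.Ext.zero_comp]
  con₁ := by
    rintro X Y Z T n ⟨i, p, w, h⟩ h₁ h₂
    refine subsingleton_ext_of_forall fun x => ?_
    obtain ⟨y, rfl⟩ := Abelian.Ext.contravariant_sequence_exact₁ h T x
      (add_comm 1 (n + 1)) (Subsingleton.elim _ _)
    rw [Subsingleton.elim (α := Abelian.Ext.{w} Y T (n + 1)) y 0, Abelian.Ext.comp_zero]
  con₂ := by
    rintro X Y Z T n ⟨i, p, w, h⟩ h₁ h₂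
    refine subsingleton_ext_of_forall fun x => ?_
    obtain ⟨y, rfl⟩ := Abelian.Ext.contravariant_sequence_exact₂ h T x (Subsingleton.elim _ _)
    rw [Subsingleton.elim (α := Abelian.Ext.{w} Z T (n + 1)) y 0, Abelian.Ext.comp_zero]
  con₃ := by
    rintro X Y Z T n ⟨i, p, w, h⟩ h₁ h₂
    refine subsingleton_ext_of_forall fun x => ?_
    obtain ⟨y, rfl⟩ := Abelian.Ext.contravariant_sequence_exact₃ h T x (Subsingleton.elim _ _)
      (add_comm 1 (n + 1))
    rw [Subsingleton.elim (α := Abelian.Ext.{w} X T (n + 1)) y 0, Abelian.Ext.comp_zero]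
  split h _ := (splitting_of_ses h).2

end ExtVanishing

/-! ### Totally acyclic complexes and orthogonality of their cokernels. -/

section Gorenstein

variable {A : Type u} [Category.{v} A] [Abelian A]

/-- Indices are linked by equations so that the lemma applies to numerals and shifted indices
without transport. -/
lemma homFrom_lift {T : ChainComplex A ℤ} {X : A} (h : (homFrom X T).Acyclic) {i j k : ℤ}
    (hij : j + 1 = i) (hjk : k + 1 = j) (φ : X ⟶ T.X j) (hφ : φ ≫ T.d j k = 0) :
    ∃ ψ : X ⟶ T.X i, ψ ≫ T.d i j = φ := by
  have h' := h j
  rw [HomologicalComplex.exactAt_iff' _ i j k (ComplexShape.prev_eq' _ hij)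
    (ComplexShape.next_eq' _ hjk), ShortComplex.ab_exact_iff] at h'
  exact h' φ hφ

lemma homTo_extend {T : ChainComplex A ℤ} {X : A} (h : (homTo T X).Acyclic) {i j k : ℤ}
    (hij : j + 1 = i) (hjk : k + 1 = j) (φ : T.X j ⟶ X) (hφ : T.d i j ≫ φ = 0) :
    ∃ ψ : T.X k ⟶ X, T.d j k ≫ ψ = φ := by
  have h' := h j
  rw [HomologicalComplex.exactAt_iff' _ k j i (ComplexShape.prev_eq' _ hjk)
    (ComplexShape.next_eq' _ hij), ShortComplex.ab_exact_iff] at h'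
  exact h' φ hφ

/-- The short exact sequence of cokernels obtained from exactness at the middle of `S`. -/
lemma shortExact_splice {S : ShortComplex A} (hS : S.Exact) :
    (ShortComplex.mk (cokernel.desc S.f S.g S.zero) (cokernel.π S.g)
      (by rw [← cancel_epi (cokernel.π S.f)]; simp)).ShortExact := by
  have := hS.mono_cokernelDesc
  refine shortExact_of_isColimit _ _ _ (CokernelCofork.IsColimit.ofπ _ _
    (fun t ht => cokernel.desc S.g t ?_) (fun t ht => ?_) (fun t ht m hm => ?_))
  · rw [← cokernel.π_desc S.f S.g S.zero, Category.assoc, ht, comp_zero]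
  · exact cokernel.π_desc _ _ _
  · rw [← cancel_epi (cokernel.π S.g), hm, cokernel.π_desc]

variable {W : ObjectProperty A}

lemma IsTotallyAcyclic.exact_sc {T : ChainComplex A ℤ} (hT : IsTotallyAcyclic W T) {i j k : ℤ}
    (hij : j + 1 = i) (hjk : k + 1 = j) : (T.sc' i j k).Exact :=
  (HomologicalComplex.exactAt_iff' _ i j k (ComplexShape.prev_eq' _ hij)
    (ComplexShape.next_eq' _ hjk)).1 (hT.exact j)

/-- The complex with terms `T_{k+n}`. -/
def shiftIndex (T : ChainComplex A ℤ) (n : ℤ) : ChainComplex A ℤ where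
  X k := T.X (k + n)
  d i j := T.d (i + n) (j + n)
  shape i j h := T.shape _ _ (fun h' => h (by
    simp only [ComplexShape.down_Rel] at h' ⊢; omega))
  d_comp_d' i j k _ _ := T.d_comp_d _ _ _

lemma IsTotallyAcyclic.shiftIndex {T : ChainComplex A ℤ} (hT : IsTotallyAcyclic W T) (n : ℤ) :
    IsTotallyAcyclic W (shiftIndex T n) where
  mem k := hT.mem (k + n)
  exact k := by
    rw [HomologicalComplex.exactAt_iff' _ (k + 1) k (k - 1) (ComplexShape.prev_eq' _ rfl)
      (ComplexShape.next_eq' _ (sub_add_cancel k 1))]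
    exact hT.exact_sc (by omega) (by omega)
  hom_from_exact X hX k := by
    rw [HomologicalComplex.exactAt_iff' _ (k + 1) k (k - 1) (ComplexShape.prev_eq' _ rfl)
      (ComplexShape.next_eq' _ (sub_add_cancel k 1)), ShortComplex.ab_exact_iff]
    exact fun φ hφ => homFrom_lift (hT.hom_from_exact X hX) (by omega) (by omega) φ hφ
  hom_to_exact X hX k := by
    rw [HomologicalComplex.exactAt_iff' _ (k - 1) k (k + 1)
      (ComplexShape.prev_eq' _ (sub_add_cancel k 1)) (ComplexShape.next_eq' _ rfl),
      ShortComplex.ab_exact_iff]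
    exact fun φ hφ => homTo_extend (hT.hom_to_exact X hX) (by omega) (by omega) φ hφ

lemma gorenstein_of_iso {M N : A} (e : M ≅ N) (hM : gorenstein W M) : gorenstein W N := by
  obtain ⟨T, hT, ⟨a⟩⟩ := hM
  exact ⟨T, hT, ⟨e.symm ≪≫ a⟩⟩

lemma IsTotallyAcyclic.gorenstein_cokernel {T : ChainComplex A ℤ} (hT : IsTotallyAcyclic W T)
    {i j : ℤ} (hij : j + 1 = i) : gorenstein W (cokernel (T.d i j)) := by
  obtain rfl : 1 + j = i := by omega
  -- The shifted complex has target index `0 + j`, which is not `j` by definition; the variable `k`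
  -- absorbs the difference.
  have key : ∀ k, k = j → gorenstein W (cokernel (T.d (1 + j) k)) := by
    intro k hk
    obtain rfl : 0 + j = k := by omega
    exact ⟨_, hT.shiftIndex j, ⟨Iso.refl _⟩⟩
  exact key j rfl

lemma IsTotallyAcyclic.shortExact {T : ChainComplex A ℤ} (hT : IsTotallyAcyclic W T) {i j k : ℤ}
    (hij : j + 1 = i) (hjk : k + 1 = j) :
    (ShortComplex.mk (cokernel.desc (T.d i j) (T.d j k) (T.d_comp_d i j k)) (cokernel.π (T.d j k))
      (by rw [← cancel_epi (cokernel.π (T.d i j))]; simp)).ShortExact :=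
  shortExact_splice (hT.exact_sc hij hjk)

lemma IsTotallyAcyclic.extend {T : ChainComplex A ℤ} (hT : IsTotallyAcyclic W T) {i j k : ℤ}
    (hij : j + 1 = i) (hjk : k + 1 = j) {X : A} (hX : W X) (f : cokernel (T.d i j) ⟶ X) :
    ∃ g : T.X k ⟶ X, cokernel.desc (T.d i j) (T.d j k) (T.d_comp_d i j k) ≫ g = f := by
  obtain ⟨g, hg⟩ := homTo_extend (hT.hom_to_exact X hX) hij hjk (cokernel.π (T.d i j) ≫ f)
    (by rw [cokernel.condition_assoc, zero_comp])
  exact ⟨g, by rw [← cancel_epi (cokernel.π (T.d i j)), cokernel.π_desc_assoc, hg]⟩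

/-- The cokernel embeds in `T_{k-1}` as the cycles there, so `f` becomes a cycle of `Hom(X, T)`,
hence a boundary. -/
lemma IsTotallyAcyclic.lift {T : ChainComplex A ℤ} (hT : IsTotallyAcyclic W T) {j k : ℤ}
    (hjk : k + 1 = j) {X : A} (hX : W X) (f : X ⟶ cokernel (T.d j k)) :
    ∃ g : X ⟶ T.X k, g ≫ cokernel.π (T.d j k) = f := by
  have hk : k - 1 + 1 = k := by omega
  have hk' : k - 1 - 1 + 1 = k - 1 := by omega
  have := (hT.exact_sc hjk hk).mono_cokernelDesc
  have : Mono (cokernel.desc (T.d j k) (T.d k (k - 1)) (T.d_comp_d _ _ _)) := this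
  obtain ⟨g, hg⟩ := homFrom_lift (hT.hom_from_exact X hX) hk hk'
    (f ≫ cokernel.desc (T.d j k) (T.d k (k - 1)) (T.d_comp_d _ _ _)) (by
      have : cokernel.desc (T.d j k) (T.d k (k - 1)) (T.d_comp_d _ _ _) ≫
          T.d (k - 1) (k - 1 - 1) = 0 := by
        rw [← cancel_epi (cokernel.π (T.d j k)), cokernel.π_desc_assoc, T.d_comp_d, comp_zero]
      rw [Category.assoc, this, comp_zero])
  refine ⟨g, ?_⟩
  rw [← cancel_mono (cokernel.desc (T.d j k) (T.d k (k - 1)) (T.d_comp_d _ _ _)), ← hg,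
    Category.assoc, cokernel.π_desc]

lemma exists_ses_right_of_gorenstein {M : A} (hM : gorenstein W M) :
    ∃ X Z, W X ∧ gorenstein W Z ∧ Ses M X Z := by
  obtain ⟨T, hT, ⟨e⟩⟩ := hM
  exact ⟨_, _, hT.mem (-1), hT.gorenstein_cokernel (i := 0) (j := -1) rfl,
    (Ses.of_shortExact (hT.shortExact (i := 1) (j := 0) (k := -1) rfl rfl)).of_iso e.symm
      (Iso.refl _) (Iso.refl _)⟩

lemma exists_ses_left_of_gorenstein {M : A} (hM : gorenstein W M) :
    ∃ X K, W X ∧ gorenstein W K ∧ Ses K X M := by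
  obtain ⟨T, hT, ⟨e⟩⟩ := hM
  exact ⟨_, _, hT.mem 0, hT.gorenstein_cokernel (i := 2) (j := 1) rfl,
    (Ses.of_shortExact (hT.shortExact (i := 2) (j := 1) (k := 0) rfl rfl)).of_iso (Iso.refl _)
      (Iso.refl _) e.symm⟩

variable [HasExt.{w} A]

/-- `Hom(-, X)`-exactness gives `Ext¹`. Higher degrees shift along `T`, which moves the cokernel,
hence the induction over all `i` and `j`. -/
lemma IsTotallyAcyclic.ext_left {T : ChainComplex A ℤ} (hT : IsTotallyAcyclic W T)
    (hW : Perp.{w} W W) {X : A} (hX : W X) (n : ℕ) {i j : ℤ} (hij : j + 1 = i) :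
    Subsingleton (Abelian.Ext.{w} (cokernel (T.d i j)) X (n + 1)) := by
  induction n generalizing i j with
  | zero =>
    have := hW (hT.mem j) hX 1 le_rfl
    exact subsingleton_ext_one_of_extend (hT.shortExact rfl hij) (hT.extend rfl hij hX)
  | succ n ih =>
    exact (isExtVanishing_ext.{w} A).con₃ (Ses.of_shortExact (hT.shortExact rfl hij)) (ih rfl)
      (hW (hT.mem j) hX _ (by omega))

lemma IsTotallyAcyclic.ext_right {T : ChainComplex A ℤ} (hT : IsTotallyAcyclic W T)
    (hW : Perp.{w} W W) {X : A} (hX : W X) (n : ℕ) {i j : ℤ} (hij : j + 1 = i) :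
    Subsingleton (Abelian.Ext.{w} X (cokernel (T.d i j)) (n + 1)) := by
  induction n generalizing i j with
  | zero =>
    have hj : j - 1 + 1 = j := by omega
    have := hW hX (hT.mem (j - 1)) 1 le_rfl
    exact subsingleton_ext_one_of_lift (hT.shortExact hij hj) (hT.lift hj hX)
  | succ n ih =>
    have hj : j - 1 + 1 = j := by omega
    exact (isExtVanishing_ext.{w} A).cov₁ (Ses.of_shortExact (hT.shortExact hij hj)) (ih hj)
      (hW hX (hT.mem (j - 1)) _ (by omega))

lemma ext_gorenstein_left (hW : Perp.{w} W W) {M X : A} (hM : gorenstein W M) (hX : W X) (n : ℕ) :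
    Subsingleton (Abelian.Ext.{w} M X (n + 1)) := by
  obtain ⟨T, hT, ⟨e⟩⟩ := hM
  have := hT.ext_left hW hX n (i := 1) (j := 0) rfl
  let a := (((Abelian.extFunctor.{w} (n + 1)).mapIso e.op).app X).addCommGroupIsoToAddEquiv
  exact a.toEquiv.symm.subsingleton (β := Abelian.Ext.{w} _ X (n + 1))

lemma ext_gorenstein_right (hW : Perp.{w} W W) {M X : A} (hM : gorenstein W M) (hX : W X) (n : ℕ) :
    Subsingleton (Abelian.Ext.{w} X M (n + 1)) := by
  obtain ⟨T, hT, ⟨e⟩⟩ := hM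
  have := hT.ext_right hW hX n (i := 1) (j := 0) rfl
  let a := (((Abelian.extFunctor.{w} (n + 1)).obj (op X)).mapIso e).addCommGroupIsoToAddEquiv
  exact a.toEquiv.subsingleton (β := Abelian.Ext.{w} X _ (n + 1))

end Gorenstein

end RelTate

namespace RelTate

/-! ### Resolutions indexed by natural numbers. -/

section Sequences

open scoped ZeroObject

/-- A resolution `⋯ → X₁ → X₀ → M → 0` indexed by natural numbers. -/
structure ResSeq {B : Type u} [Category.{v} B] [Abelian B] (M : B) where
  X : ℕ → B
  δ : ∀ n, X (n + 1) ⟶ X n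
  ε : X 0 ⟶ M
  δ_ε : δ 0 ≫ ε = 0
  δ_δ : ∀ n, δ (n + 1) ≫ δ n = 0
  epi : Epi ε
  exact_zero : (ShortComplex.mk (δ 0) ε δ_ε).Exact
  exact_succ : ∀ n, (ShortComplex.mk (δ (n + 1)) (δ n) (δ_δ n)).Exact

variable {B : Type u} [Category.{v} B] [Abelian B]

lemma exact_of_mono_comp {X Y Z Z' : B} (f : X ⟶ Y) (g : Y ⟶ Z) (i : Z ⟶ Z') [Mono i]
    (w : f ≫ g = 0) (w' : f ≫ g ≫ i = 0) :
    (ShortComplex.mk f g w).Exact ↔ (ShortComplex.mk f (g ≫ i) w').Exact :=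
  ShortComplex.exact_iff_of_epi_of_isIso_of_mono
    (S₁ := ShortComplex.mk f g w) (S₂ := ShortComplex.mk f (g ≫ i) w')
    { τ₁ := 𝟙 _, τ₂ := 𝟙 _, τ₃ := i }

lemma exact_of_epi_comp {X' X Y Z : B} (q : X' ⟶ X) [Epi q] (f : X ⟶ Y) (g : Y ⟶ Z)
    (w : f ≫ g = 0) (w' : (q ≫ f) ≫ g = 0) :
    (ShortComplex.mk (q ≫ f) g w').Exact ↔ (ShortComplex.mk f g w).Exact :=
  ShortComplex.exact_iff_of_epi_of_isIso_of_mono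
    (S₁ := ShortComplex.mk (q ≫ f) g w') (S₂ := ShortComplex.mk f g w)
    { τ₁ := q, τ₂ := 𝟙 _, τ₃ := 𝟙 _ }

/-- The resolution of the first syzygy. -/
noncomputable def ResSeq.tail {M : B} (R : ResSeq M) : ResSeq (kernel R.ε) where
  X n := R.X (n + 1)
  δ n := R.δ (n + 1)
  ε := kernel.lift R.ε (R.δ 0) R.δ_ε
  δ_ε := by rw [← cancel_mono (kernel.ι R.ε)]; simp [R.δ_δ]
  δ_δ n := R.δ_δ (n + 1)
  epi := R.exact_zero.epi_kernelLift
  exact_zero := by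
    rw [exact_of_mono_comp _ _ (kernel.ι R.ε) _ (by simp [R.δ_δ])]
    simpa only [kernel.lift_ι] using R.exact_succ 0
  exact_succ n := R.exact_succ (n + 1)

/-- Extension of a resolution along a short exact sequence. -/
def ResSeq.cons {K Y M : B} (R : ResSeq K) (i : K ⟶ Y) (p : Y ⟶ M) (w : i ≫ p = 0)
    (h : (ShortComplex.mk i p w).ShortExact) : ResSeq M where
  X
    | 0 => Y
    | n + 1 => R.X n
  δ
    | 0 => R.ε ≫ i
    | n + 1 => R.δ n
  ε := p
  δ_ε := by simp [w]
  δ_δ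
    | 0 => by
      change R.δ 0 ≫ R.ε ≫ i = 0
      rw [reassoc_of% R.δ_ε, zero_comp]
    | n + 1 => R.δ_δ n
  epi := h.epi_g
  exact_zero := by
    have := R.epi
    exact (exact_of_epi_comp R.ε i p w (by simp [w])).2 h.exact
  exact_succ
    | 0 => by
      have : Mono i := h.mono_f
      exact (exact_of_mono_comp _ _ i R.δ_ε _).1 R.exact_zero
    | n + 1 => R.exact_succ n

/-- The resolution of length zero of an object by itself. -/
noncomputable def ResSeq.self (M : B) : ResSeq M where
  X
    | 0 => M
    | _ + 1 => 0
  δ _ := 0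
  ε := 𝟙 M
  δ_ε := zero_comp
  δ_δ _ := zero_comp
  epi := inferInstance
  exact_zero := (ShortComplex.exact_iff_mono _ rfl).2 (inferInstanceAs (Mono (𝟙 M)))
  exact_succ _ := ShortComplex.exact_of_isZero_X₂ _ (isZero_zero B)

lemma ses_kernel {M : B} (R : ResSeq M) : Ses (kernel R.ε) (R.X 0) M :=
  ⟨kernel.ι R.ε, R.ε, kernel.condition _,
    { exact := ShortComplex.exact_kernel R.ε, mono_f := inferInstance, epi_g := R.epi }⟩

lemma ResSeq.hasResDim {P : ObjectProperty B} [P.IsClosedUnderIsomorphisms] {M : B} (R : ResSeq M)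
    (hP : ∀ n, P (R.X n)) {d : ℕ} (hd : ∀ n, d < n → IsZero (R.X n)) : HasResDim P d M := by
  induction d generalizing M with
  | zero =>
    -- As `X 1` vanishes, exactness at `X 0` makes `ε` a monomorphism, hence an isomorphism.
    have : Mono R.ε := (ShortComplex.exact_iff_mono _ ((hd 1 one_pos).eq_of_src _ _)).1 R.exact_zero
    have := R.epi
    have := isIso_of_mono_of_epi R.ε
    exact P.prop_of_iso (asIso R.ε) (hP 0)
  | succ d ih =>
    exact ⟨_, _, hP 0, ses_kernel R, ih R.tail (fun n => hP (n + 1))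
      (fun n hn => hd (n + 1) (by omega))⟩

lemma HasResDim.exists_resSeq {P : ObjectProperty B} (hP0 : P 0) {M : B} {d : ℕ}
    (h : HasResDim P d M) :
    ∃ R : ResSeq M, (∀ n, P (R.X n)) ∧ ∀ n, d < n → IsZero (R.X n) := by
  induction d generalizing M with
  | zero =>
    refine ⟨ResSeq.self M, fun n => ?_, fun n hn => ?_⟩
    · cases n
      · exact h
      · exact hP0
    · obtain ⟨n, rfl⟩ : ∃ m, n = m + 1 := ⟨n - 1, by omega⟩
      exact isZero_zero B
  | succ d ih =>
    obtain ⟨K, X, hX, ⟨i, p, w, hs⟩, hK⟩ := h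
    obtain ⟨R, h₁, h₂⟩ := ih hK
    refine ⟨R.cons i p w hs, fun n => ?_, fun n hn => ?_⟩
    · cases n
      · exact hX
      · exact h₁ _
    · obtain ⟨n, rfl⟩ : ∃ m, n = m + 1 := ⟨n - 1, by omega⟩
      exact h₂ n (by omega)

end Sequences

/-! ### Translation between complexes over the integers and iterated syzygies. -/

section Complexes

variable {A : Type u} [Category.{v} A] [Abelian A]

open scoped ZeroObject

/-- Since nothing leaves degree zero, the condition there is exactness of `X₁ → X₀ → M → 0`;
elsewhere the target is acyclic. -/
lemma quasiIso_toSingle_iff {X : ChainComplex A ℤ} {M : A} (γ : X ⟶ inDegreeZero M)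
    (hX : X.d 0 (-1) = 0)
    (w : X.d 1 0 ≫ γ.f 0 ≫ (HomologicalComplex.singleObjXSelf _ 0 M).hom = 0) :
    QuasiIso γ ↔ (∀ n : ℤ, n ≠ 0 → X.ExactAt n) ∧ (ShortComplex.mk _ _ w).Exact ∧
        Epi (γ.f 0 ≫ (HomologicalComplex.singleObjXSelf (ComplexShape.down ℤ) 0 M).hom) := by
  have h₀ : QuasiIsoAt γ 0 ↔ (ShortComplex.mk _ _ w).Exact ∧
      Epi (γ.f 0 ≫ (HomologicalComplex.singleObjXSelf (ComplexShape.down ℤ) 0 M).hom) := by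
    rw [quasiIsoAt_iff' γ 1 0 (-1) (ComplexShape.prev_eq' _ rfl) (ComplexShape.next_eq' _ (by simp)),
      ShortComplex.quasiIso_iff_of_zeros' _ hX
        (HomologicalComplex.single_obj_d (ComplexShape.down ℤ) 0 M _ _)
        (HomologicalComplex.single_obj_d (ComplexShape.down ℤ) 0 M _ _)]
    refine and_congr (exact_of_mono_comp _ _ _ (by rw [← γ.comm]; simp) w) ⟨fun h => ?_, fun h => ?_⟩
    · have : Epi (γ.f 0) := h
      infer_instance
    · have := epi_comp (γ.f 0 ≫ (HomologicalComplex.singleObjXSelf (ComplexShape.down ℤ) 0 M).hom)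
        (HomologicalComplex.singleObjXSelf (ComplexShape.down ℤ) 0 M).inv
      change Epi (γ.f 0)
      simpa using this
  rw [quasiIso_iff, ← h₀]
  have h₁ : ∀ n : ℤ, n ≠ 0 → (QuasiIsoAt γ n ↔ X.ExactAt n) := fun n hn =>
    quasiIsoAt_iff_exactAt' γ n (HomologicalComplex.exactAt_single_obj _ 0 M n hn)
  refine ⟨fun h => ⟨fun n hn => (h₁ n hn).1 (h n), h 0⟩, fun h n => ?_⟩
  by_cases hn : n = 0
  · subst hn
    exact h.2
  · exact (h₁ n hn).2 (h.1 n hn)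

lemma quasiIso_fromSingle_iff {Y : ChainComplex A ℤ} {N : A} (δ : inDegreeZero N ⟶ Y)
    (hY : Y.d 1 0 = 0)
    (w : ((HomologicalComplex.singleObjXSelf _ 0 N).inv ≫ δ.f 0) ≫ Y.d 0 (-1) = 0) :
    QuasiIso δ ↔ (∀ n : ℤ, n ≠ 0 → Y.ExactAt n) ∧ (ShortComplex.mk _ _ w).Exact ∧
        Mono ((HomologicalComplex.singleObjXSelf (ComplexShape.down ℤ) 0 N).inv ≫ δ.f 0) := by
  have h₀ : QuasiIsoAt δ 0 ↔ (ShortComplex.mk _ _ w).Exact ∧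
      Mono ((HomologicalComplex.singleObjXSelf (ComplexShape.down ℤ) 0 N).inv ≫ δ.f 0) := by
    rw [quasiIsoAt_iff' δ 1 0 (-1) (ComplexShape.prev_eq' _ rfl) (ComplexShape.next_eq' _ (by simp)),
      ShortComplex.quasiIso_iff_of_zeros _
        (HomologicalComplex.single_obj_d (ComplexShape.down ℤ) 0 N _ _)
        (HomologicalComplex.single_obj_d (ComplexShape.down ℤ) 0 N _ _) hY]
    refine and_congr (exact_of_epi_comp _ _ _ (by rw [δ.comm]; simp) w).symm ⟨fun h => ?_, fun h => ?_⟩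
    · have : Mono (δ.f 0) := h
      infer_instance
    · have := mono_comp (HomologicalComplex.singleObjXSelf (ComplexShape.down ℤ) 0 N).hom
        ((HomologicalComplex.singleObjXSelf (ComplexShape.down ℤ) 0 N).inv ≫ δ.f 0)
      change Mono (δ.f 0)
      simpa using this
  rw [quasiIso_iff, ← h₀]
  have h₁ : ∀ n : ℤ, n ≠ 0 → (QuasiIsoAt δ n ↔ Y.ExactAt n) := fun n hn =>
    quasiIsoAt_iff_exactAt δ n (HomologicalComplex.exactAt_single_obj _ 0 N n hn)
  refine ⟨fun h => ⟨fun n hn => (h₁ n hn).1 (h n), h 0⟩, fun h n => ?_⟩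
  by_cases hn : n = 0
  · subst hn
    exact h.2
  · exact (h₁ n hn).2 (h.1 n hn)

lemma exactAt_iff_of_add_one {X : ChainComplex A ℤ} {i j k : ℤ} (hij : j + 1 = i)
    (hjk : k + 1 = j) : X.ExactAt j ↔ (X.sc' i j k).Exact :=
  HomologicalComplex.exactAt_iff' _ i j k (ComplexShape.prev_eq' _ hij)
    (ComplexShape.next_eq' _ hjk)

lemma exists_hasResDim_of_finiteProjDim {P : ObjectProperty A} [P.IsClosedUnderIsomorphisms]
    {M : A} (h : finiteProjDim P M) : ∃ d, HasResDim P d M := by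
  obtain ⟨d, X, γ, hX, hd⟩ := h
  have w : X.d 1 0 ≫ γ.f 0 ≫ (HomologicalComplex.singleObjXSelf _ 0 M).hom = 0 := by
    rw [← γ.comm_assoc]; simp
  obtain ⟨h₁, h₂, h₃⟩ := (quasiIso_toSingle_iff γ
    ((hX.isZero (-1) (by norm_num)).eq_of_tgt _ _) w).1 hX.quasiIso
  let R : ResSeq M :=
    { X n := X.X (n : ℤ)
      δ n := X.d ((n + 1 : ℕ) : ℤ) (n : ℤ)
      ε := γ.f 0 ≫ (HomologicalComplex.singleObjXSelf _ 0 M).hom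
      δ_ε := w
      δ_δ n := X.d_comp_d _ _ _
      epi := h₃
      exact_zero := h₂
      exact_succ n := (exactAt_iff_of_add_one (i := ((n + 1 + 1 : ℕ) : ℤ)) (k := (n : ℤ))
        (by push_cast; ring) (by push_cast; ring)).1 (h₁ ((n + 1 : ℕ) : ℤ) (by omega)) }
  exact ⟨d, R.hasResDim (fun n => hX.mem _) (fun n hn => hd _ (by exact_mod_cast hn))⟩

lemma exists_hasCoresDim_of_finiteInjDim {P : ObjectProperty A} [P.IsClosedUnderIsomorphisms]
    {N : A} (h : finiteInjDim P N) : ∃ d, HasCoresDim P d N := by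
  obtain ⟨d, Y, δ, hY, hd⟩ := h
  have w : ((HomologicalComplex.singleObjXSelf _ 0 N).inv ≫ δ.f 0) ≫ Y.d 0 (-1) = 0 := by
    rw [Category.assoc, δ.comm]; simp
  obtain ⟨h₁, h₂, h₃⟩ := (quasiIso_fromSingle_iff δ
    ((hY.isZero 1 (by norm_num)).eq_of_src _ _) w).1 hY.quasiIso
  -- A coresolution of `N` is a resolution of `op N`, with degree `-n` in position `n`.
  let R : ResSeq (op N) :=
    { X n := op (Y.X (-(n : ℤ)))
      δ n := (Y.d (-(n : ℤ)) (-((n + 1 : ℕ) : ℤ))).op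
      ε := ((HomologicalComplex.singleObjXSelf _ 0 N).inv ≫ δ.f 0).op
      δ_ε := Quiver.Hom.unop_inj w
      δ_δ n := Quiver.Hom.unop_inj (Y.d_comp_d _ _ _)
      epi := inferInstance
      exact_zero := h₂.op
      exact_succ n := ((exactAt_iff_of_add_one (i := -(n : ℤ)) (k := -((n + 1 + 1 : ℕ) : ℤ))
        (by push_cast; ring) (by push_cast; ring)).1 (h₁ (-((n + 1 : ℕ) : ℤ)) (by omega))).op }
  exact ⟨d, (hasResDim_op_iff P d N).1
    (R.hasResDim (fun n => hY.mem _) (fun n hn => (hd _ (by omega)).op))⟩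

/-- The terms of a resolution, extended by zero to negative degrees. -/
noncomputable def ResSeq.intX {M : A} (R : ResSeq M) : ℤ → A
  | Int.ofNat n => R.X n
  | Int.negSucc _ => 0

/-- The differentials between the terms `ResSeq.intX`. -/
noncomputable def ResSeq.intD {M : A} (R : ResSeq M) : ∀ n, R.intX (n + 1) ⟶ R.intX n
  | Int.ofNat n => R.δ n
  | Int.negSucc _ => 0

lemma ResSeq.intD_comp {M : A} (R : ResSeq M) : ∀ n, R.intD (n + 1) ≫ R.intD n = 0
  | Int.ofNat n => R.δ_δ n
  | Int.negSucc _ => comp_zero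

/-- The complex with the terms of a resolution in nonnegative degrees. -/
noncomputable def ResSeq.toComplex {M : A} (R : ResSeq M) : ChainComplex A ℤ :=
  ChainComplex.of R.intX R.intD R.intD_comp

/-- The terms of a coresolution, extended by zero to positive degrees. -/
noncomputable def ResSeq.opIntX {N : A} (R : ResSeq (op N)) : ℤ → A
  | Int.ofNat 0 => (R.X 0).unop
  | Int.ofNat (_ + 1) => 0
  | Int.negSucc n => (R.X (n + 1)).unop

/-- The differentials between the terms `ResSeq.opIntX`. -/
noncomputable def ResSeq.opIntD {N : A} (R : ResSeq (op N)) : ∀ n, R.opIntX (n + 1) ⟶ R.opIntX n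
  | Int.ofNat _ => 0
  | Int.negSucc 0 => (R.δ 0).unop
  | Int.negSucc (n + 1) => (R.δ (n + 1)).unop

lemma ResSeq.opIntD_comp {N : A} (R : ResSeq (op N)) : ∀ n, R.opIntD (n + 1) ≫ R.opIntD n = 0
  | Int.ofNat _ => comp_zero
  | Int.negSucc 0 => zero_comp
  | Int.negSucc 1 => Quiver.Hom.op_inj (R.δ_δ 0)
  | Int.negSucc (n + 2) => Quiver.Hom.op_inj (R.δ_δ (n + 1))

/-- The complex with the terms of a coresolution in nonpositive degrees. -/
noncomputable def ResSeq.toOpComplex {N : A} (R : ResSeq (op N)) : ChainComplex A ℤ :=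
  ChainComplex.of R.opIntX R.opIntD R.opIntD_comp

lemma exactAt_of {X : ℤ → A} {d : ∀ n, X (n + 1) ⟶ X n} {sq : ∀ n, d (n + 1) ≫ d n = 0} (n : ℤ)
    (h : (ShortComplex.mk (d (n + 1)) (d n) (sq n)).Exact) :
    (ChainComplex.of X d sq).ExactAt (n + 1) := by
  rw [exactAt_iff_of_add_one (i := n + 1 + 1) (k := n) rfl rfl]
  have : (ChainComplex.of X d sq).sc' (n + 1 + 1) (n + 1) n =
      ShortComplex.mk (d (n + 1)) (d n) (sq n) := by
    dsimp [HomologicalComplex.sc', HomologicalComplex.shortComplexFunctor']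
    congr 1 <;> exact ChainComplex.of_d _ _ _
  rw [this]
  exact h

lemma HasResDim.finiteProjDim {P : ObjectProperty A} (hP0 : P 0) {M : A} {d : ℕ}
    (h : HasResDim P d M) : finiteProjDim P M := by
  obtain ⟨R, h₁, h₂⟩ := h.exists_resSeq hP0
  let ε : R.toComplex.X 0 ⟶ M := R.ε
  have hd : R.toComplex.d 1 0 = R.δ 0 :=
    ChainComplex.of_d R.intX R.intD 0
  have hw₀ : R.toComplex.d 1 0 ≫ ε = 0 := by
    rw [hd]
    exact R.δ_ε
  have hw : ∀ i : ℤ, (ComplexShape.down ℤ).Rel i 0 → R.toComplex.d i 0 ≫ ε = 0 := by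
    rintro i hi
    obtain rfl : (1 : ℤ) = i := by simpa using hi
    exact hw₀
  have hz : ∀ n : ℤ, n < 0 → IsZero (R.toComplex.X n) := by
    rintro (n | n) hn
    · exact absurd hn (not_lt.2 (Int.natCast_nonneg n))
    · exact isZero_zero A
  refine ⟨d, R.toComplex, HomologicalComplex.mkHomToSingle ε hw, ⟨?_, hz, ?_⟩, ?_⟩
  · rintro (n | n)
    · exact h₁ n
    · exact hP0
  · have hγ : (HomologicalComplex.mkHomToSingle ε hw).f 0 ≫
        (HomologicalComplex.singleObjXSelf (ComplexShape.down ℤ) 0 M).hom = ε := by simp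
    have hγ' : R.toComplex.d 1 0 ≫ (HomologicalComplex.mkHomToSingle ε hw).f 0 ≫
        (HomologicalComplex.singleObjXSelf (ComplexShape.down ℤ) 0 M).hom = 0 := by rw [hγ, hw₀]
    rw [quasiIso_toSingle_iff _ ((hz (-1) (by norm_num)).eq_of_tgt _ _) hγ']
    refine ⟨?_, ?_, ?_⟩
    · rintro ((_ | n) | n) hn
      · exact absurd rfl hn
      · exact exactAt_of (sq := R.intD_comp) (Int.ofNat n) (R.exact_succ n)
      · exact HomologicalComplex.ExactAt.of_isZero (hz _ (Int.negSucc_lt_zero n))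
    · simp only [hγ, hd]
      exact R.exact_zero
    · rw [hγ]
      exact R.epi
  · rintro (n | n) hn
    · exact h₂ n (Int.ofNat_lt.1 hn)
    · exact isZero_zero A

lemma HasCoresDim.finiteInjDim {P : ObjectProperty A} [P.IsClosedUnderIsomorphisms]
    (hP0 : P 0) {N : A} {d : ℕ}
    (h : HasCoresDim P d N) : finiteInjDim P N := by
  obtain ⟨R, h₁, h₂⟩ := ((hasResDim_op_iff P d N).2 h).exists_resSeq
    -- The zero object chosen in `Aᵒᵖ` need not unop to the one chosen in `A`; they are only
    -- isomorphic.
    (show P (0 : Aᵒᵖ).unop from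
      P.prop_of_iso (IsZero.iso (isZero_zero A) (isZero_zero Aᵒᵖ).unop) hP0)
  let η : N ⟶ R.toOpComplex.X 0 := R.ε.unop
  have hd : R.toOpComplex.d 0 (-1) = (R.δ 0).unop :=
    ChainComplex.of_d R.opIntX R.opIntD (Int.negSucc 0)
  have hw₀ : η ≫ R.toOpComplex.d 0 (-1) = 0 := by
    rw [hd]
    exact Quiver.Hom.op_inj R.δ_ε
  have hw : ∀ i : ℤ, (ComplexShape.down ℤ).Rel 0 i → η ≫ R.toOpComplex.d 0 i = 0 := by
    rintro i hi
    obtain rfl : (-1 : ℤ) = i := by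
      simp only [ComplexShape.down_Rel] at hi
      omega
    exact hw₀
  have hz : ∀ n : ℤ, 0 < n → IsZero (R.toOpComplex.X n) := by
    rintro ((_ | n) | n) hn
    · exact absurd hn (lt_irrefl 0)
    · exact isZero_zero A
    · exact absurd hn (not_lt.2 (Int.negSucc_lt_zero n).le)
  refine ⟨d, R.toOpComplex, HomologicalComplex.mkHomFromSingle η hw, ⟨?_, hz, ?_⟩, ?_⟩
  · rintro ((_ | n) | n)
    · exact h₁ 0
    · exact hP0
    · exact h₁ (n + 1)
  · have hγ : (HomologicalComplex.singleObjXSelf (ComplexShape.down ℤ) 0 N).inv ≫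
        (HomologicalComplex.mkHomFromSingle η hw).f 0 = η := by simp
    have hγ' : ((HomologicalComplex.singleObjXSelf (ComplexShape.down ℤ) 0 N).inv ≫
        (HomologicalComplex.mkHomFromSingle η hw).f 0) ≫ R.toOpComplex.d 0 (-1) = 0 := by
      rw [hγ, hw₀]
    rw [quasiIso_fromSingle_iff _ ((hz 1 (by norm_num)).eq_of_src _ _) hγ']
    refine ⟨?_, ?_, ?_⟩
    · rintro ((_ | n) | (_ | n)) hn
      · exact absurd rfl hn
      · exact HomologicalComplex.ExactAt.of_isZero (isZero_zero A)
      -- `Int.negSucc 1` is `-2`, and `exactAt_of` concludes one degree higher, in degree `-1`.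
      · exact exactAt_of (sq := R.opIntD_comp) (Int.negSucc 1) (R.exact_succ 0).unop
      · exact exactAt_of (sq := R.opIntD_comp) (Int.negSucc (n + 2)) (R.exact_succ (n + 1)).unop
    · simp only [hγ, hd]
      exact R.exact_zero.unop
    · rw [hγ]
      have := R.epi
      exact inferInstanceAs (Mono R.ε.unop)
  · rintro ((_ | n) | n) hn
    · exact absurd hn (not_lt.2 (neg_nonpos.2 (Int.natCast_nonneg d)))
    · exact isZero_zero A
    · exact (h₂ (n + 1) (by omega)).unop

end Complexes

end RelTate

namespace RelTate

/-! ### Closure properties in terms of short exact sequences. -/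

section Closure

variable {A : Type u} [Category.{v} A] [Abelian A]

open scoped ZeroObject

instance (W : ObjectProperty A) : (gorenstein W).IsClosedUnderIsomorphisms where
  of_iso e h := gorenstein_of_iso e h

lemma prop_zero_of_finiteProducts (W : ObjectProperty A) [W.IsClosedUnderFiniteProducts] : W 0 :=
  W.prop_of_isTerminal _ (isZero_zero A).isTerminal

lemma ClosedUnderKernelsOfEpis.ses {W : ObjectProperty A} (h : ClosedUnderKernelsOfEpis W)
    {X Y Z : A} (hs : Ses X Y Z) (hY : W Y) (hZ : W Z) : W X := by
  obtain ⟨i, p, w, hs⟩ := hs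
  exact h _ hs hY hZ

lemma ClosedUnderCokernelsOfMonos.ses {W : ObjectProperty A} (h : ClosedUnderCokernelsOfMonos W)
    {X Y Z : A} (hs : Ses X Y Z) (hX : W X) (hY : W Y) : W Z := by
  obtain ⟨i, p, w, hs⟩ := hs
  exact h _ hs hX hY

variable [HasExt.{w} A]

lemma Perp.extension {W : ObjectProperty A} [W.IsClosedUnderIsomorphisms]
    [W.IsClosedUnderFiniteProducts] (hW : Perp.{w} W W) {X Y Z : A} (h : Ses X Y Z) (hX : W X)
    (hZ : W Z) : W Y := by
  have := hW hZ hX 1 le_rfl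
  obtain ⟨⟨e⟩, -⟩ := splitting_of_ses h
  exact W.prop_of_iso e.symm
    (W.prop_of_isLimit_binaryFan (BinaryBiproduct.isLimit X Z) hX hZ)

lemma ClosedUnderDirectSummands.ses {W : ObjectProperty A} [W.IsClosedUnderIsomorphisms]
    (hW : ClosedUnderDirectSummands W) {X Y Z : A} (h : Ses X Y Z)
    (hE : Subsingleton (Abelian.Ext.{w} Z X 1)) (hY : W Y) : W X ∧ W Z := by
  obtain ⟨⟨e⟩, -⟩ := splitting_of_ses h
  exact ⟨hW X Z (W.prop_of_iso e hY), hW Z X (W.prop_of_iso (e ≪≫ biprod.braiding X Z) hY)⟩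

end Closure

end RelTate

/-- The argument does not use the two Tate vanishing hypotheses: an object of finite
`𝒢(W)`-projective dimension is automatically right orthogonal to `W`, which is what the dimension
shift in `IsCoresolvedClass.dimension_shift` needs, and dually. -/
theorem theorem6p4 {A : Type u} [Category.{v} A] [Abelian A] [HasExt.{w} A]
    (W V : ObjectProperty A)
    [W.IsClosedUnderIsomorphisms] [W.IsClosedUnderFiniteProducts]
    [V.IsClosedUnderIsomorphisms] [V.IsClosedUnderFiniteProducts]
    (hWW : RelTate.Perp.{w} W W) (hVV : RelTate.Perp.{w} V V)
    (hGWV : RelTate.Perp.{w} (RelTate.gorenstein W) V)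
    (hWGV : RelTate.Perp.{w} W (RelTate.gorenstein V))
    (hWker : RelTate.ClosedUnderKernelsOfEpis W)
    (hWsum : RelTate.ClosedUnderDirectSummands W)
    (hVcoker : RelTate.ClosedUnderCokernelsOfMonos V)
    (hVsum : RelTate.ClosedUnderDirectSummands V)
    (hExtW : RelTate.TateExtVanishesLeft W (RelTate.finiteProjDim W) V)
    (hExtV : RelTate.TateExtVanishesRight V W (RelTate.finiteInjDim V)) :
    (∀ M : A, RelTate.finiteProjDim (RelTate.gorenstein W) M → RelTate.finiteInjDim V M →
      RelTate.finiteProjDim W M) ∧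
    (∀ N : A, RelTate.finiteInjDim (RelTate.gorenstein V) N → RelTate.finiteProjDim W N →
      RelTate.finiteInjDim V N) := by
  open RelTate in
  have hE := isExtVanishing_ext.{w} A
  constructor
  · intro M hM hM'
    obtain ⟨d, hd⟩ := exists_hasResDim_of_finiteProjDim hM
    obtain ⟨e, he⟩ := exists_hasCoresDim_of_finiteInjDim hM'
    have hP : IsCoresolvedClass (fun n X Y => Subsingleton (Abelian.Ext.{w} X Y (n + 1))) W V
        (gorenstein W) :=
      { right := fun hY => exists_ses_right_of_gorenstein hY
        perp_left := fun hY hX n => ext_gorenstein_left hWW hY hX n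
        perp_right := fun hY hX n => ext_gorenstein_right hWW hY hX n
        perp_other := fun hY hX n => hGWV hY hX (n + 1) (by omega) }
    exact (hP.hasResDim hE hWW.extension hWker.ses (fun h h' hY => (hWsum.ses h h' hY).1)
      hd he).finiteProjDim (prop_zero_of_finiteProducts W)
  · intro N hN hN'
    obtain ⟨d, hd⟩ := exists_hasCoresDim_of_finiteInjDim hN
    obtain ⟨e, he⟩ := exists_hasResDim_of_finiteProjDim hN'
    -- In `Aᵒᵖ` the roles of `W` and `V` are exchanged, and the left half of a totally `V`-acyclic
    -- complex supplies the cosyzygies.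
    have hP : IsCoresolvedClass (B := Aᵒᵖ)
        (fun n X Y => Subsingleton (Abelian.Ext.{w} Y.unop X.unop (n + 1))) V.op W.op
        (gorenstein V).op :=
      { right := fun hY => by
          obtain ⟨X, K, hX, hK, h⟩ := exists_ses_left_of_gorenstein hY
          exact ⟨op X, op K, hX, hK, h.op⟩
        perp_left := fun hY hX n => ext_gorenstein_right hVV hY hX n
        perp_right := fun hY hX n => ext_gorenstein_left hVV hY hX n
        perp_other := fun hY hX n => hWGV hX hY (n + 1) (by omega) }
    have := hP.hasResDim hE.op (fun h hX hZ => hVV.extension h.unop hZ hX)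
      (fun h hY hZ => hVcoker.ses h.unop hZ hY) (fun h h' hY => (hVsum.ses h.unop h' hY).2)
      ((hasResDim_op_iff _ _ _).2 hd) ((hasCoresDim_op_iff _ _ _).2 he)
    exact ((hasResDim_op_iff _ _ _).1 this).finiteInjDim (prop_zero_of_finiteProducts V)
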